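/- All groups are abelian. A group $A$ is a *Whitehead group* if $\operatorname{Ext}(A,\mathbb Z)=0$. A group is *$\aleph_1$-free* if each of its countable subgroups is free, and a group $A$ is *strongly $\aleph_1$-free* if every countable subset of $A$ is contained in a free subgroup $B$ such that $A/B$ is $\aleph_1$-free. For a group $A$ of cardinality $\aleph_1$ that is a Whitehead group (and hence $\aleph_1$-free), write $\Gamma(A)=1$ if $A=\bigcup_{\alpha<\omega_1}A_\alpha$ for some continuous increasing chain $(A_\alpha)_{\alpha<\omega_1}$ of countable subgroups (continuous: $A_\delta=\bigcup_{\alpha<\delta}A_\alpha$ for every nonzero limit ordinal $\delta<\omega_1$) such that $A_{\delta+1}/A_\delta$ is not free for every nonzero limit ordinal $\delta<\omega_1$. **Theorem.** If there is a Whitehead group $A$ of cardinality $\aleph_1$ with $\Gamma(A)=1$, then there is a Whitehead group $G$ of cardinality $\aleph_1$ that is not strongly $\aleph_1$-free. -/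

import Mathlib

open scoped Cardinal Ordinal

/-- A Whitehead group (W-group): an abelian group `A` with `Ext(A, ℤ) = 0`, where `Ext = Ext¹`
is computed in the category of `ℤ`-modules. -/
def IsWhitehead (A : Type) [AddCommGroup A] : Prop :=
  Subsingleton (CategoryTheory.Abelian.Ext (ModuleCat.of ℤ A) (ModuleCat.of ℤ ℤ) 1)

/-- An abelian group is `ℵ₁`-free if all its countable subgroups are free. -/
def IsAlephOneFree (A : Type) [AddCommGroup A] : Prop :=
  ∀ B : AddSubgroup A, Countable B → Module.Free ℤ B

/-- An abelian group `A` is strongly `ℵ₁`-free if every countable subset of `A` is contained in a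
free subgroup `B` such that `A / B` is `ℵ₁`-free. -/
def IsStronglyAlephOneFree (A : Type) [AddCommGroup A] : Prop :=
  ∀ X : Set A, X.Countable →
    ∃ B : AddSubgroup A, X ⊆ B ∧ Module.Free ℤ B ∧ IsAlephOneFree (A ⧸ B)

/-- The sequence `(C α)_{α < ω₁}` is a continuous chain of countable subgroups with union `A`.
Values of `C` at ordinals `≥ ω₁` are irrelevant. -/
structure IsCountableFiltration {A : Type} [AddCommGroup A]
    (C : Ordinal.{0} → AddSubgroup A) : Prop where
  countable : ∀ α, α < ω₁ → Countable (C α)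
  mono : ∀ α β, α ≤ β → β < ω₁ → C α ≤ C β
  continuous : ∀ δ, Order.IsSuccLimit δ → δ < ω₁ → ∀ a ∈ C δ, ∃ α < δ, a ∈ C α
  exhaust : ∀ a : A, ∃ α < ω₁, a ∈ C α

/-- `Γ(A) = 1`: the group `A` is the union of a continuous chain `(C α)_{α < ω₁}` of countable
subgroups such that `C (α + 1) / C α` is not free for every (nonzero) limit ordinal `α < ω₁`. -/
def GammaEqOne (A : Type) [AddCommGroup A] : Prop :=
  ∃ C : Ordinal.{0} → AddSubgroup A, IsCountableFiltration C ∧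
    ∀ α, Order.IsSuccLimit α → α < ω₁ →
      ¬ Module.Free ℤ (C (α + 1) ⧸ (C α).addSubgroupOf (C (α + 1)))

/-! As `ℚ` is injective, `Ext(A, ℤ) = 0` says that every character `A → ℚ / ℤ` lifts to `ℚ`.
Countable groups with this property are free (Stein). So, once the filtration is thinned out to pure
stages, each proper step `C (α + 1) / C α` carries a character without a lift, and since `A / C α`
is torsion-free that character can be divided by any `v ≠ 0`.

The group sought is the union of a chain `0 = G 0 ≤ G 1 ≤ ...` with `G (j + 1) / G j ≅ A`, built
inside `ℕ →₀ E` for `E` the divisible hull of `A`. Any such union is Whitehead, because lifts extend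
one step at a time. The freedom in choosing the extensions is used to twist them: for `g` in the
chain at stage `α + 1` and an integer `v`, some `G (j + 1)` contains, over each `a ∈ C (α + 1)`, an
element `q • g + d + a` with `a` in coordinate `j`, `q` representing `χ α v a`, and `d` in the
rational span of stage `α`. An integer-valued homomorphism that kills stage `α` and takes the value
`-v ≠ 0` at `g` would then give a lift of `v • χ α v` over `C (α + 1)`, which is impossible.

Hence, by induction on `α`, a homomorphism from the union to an `ℵ₁`-free group is zero as soon as
it kills the countable stage `0`. A subgroup `B` containing that stage with `ℵ₁`-free quotient must
be everything; were it free, being uncountable, it would have a nonzero coordinate functional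
killing stage `0`. -/

/-- The discrete group `ℚ / ℤ`. -/
abbrev RatModInt : Type := AddCircle (1 : ℚ)

/-- Every character `A → ℚ / ℤ` lifts to a homomorphism `A → ℚ`; this is equivalent to
`Ext(A, ℤ) = 0`, see `isWhitehead_iff_liftsCharacters`. -/
def LiftsCharacters (A : Type) [AddCommGroup A] : Prop :=
  ∀ χ : A →+ RatModInt, ∃ f : A →+ ℚ, ∀ a, (f a : RatModInt) = χ a

theorem ratModInt_coe_eq_zero_iff (q : ℚ) : (q : RatModInt) = 0 ↔ ∃ n : ℤ, (n : ℚ) = q := by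
  rw [AddCircle.coe_eq_zero_iff]
  simp

/-- A homomorphism into a divisible group factors through any homomorphism with smaller kernel. -/
theorem exists_factor_of_ker_le {G A D : Type*} [AddCommGroup G] [AddCommGroup A] [AddCommGroup D]
    [DivisibleBy D ℤ] (p : G →+ A) (χ : G →+ D) (h : ∀ x, p x = 0 → χ x = 0) :
    ∃ η : A →+ D, ∀ x, η (p x) = χ x := by
  obtain ⟨η, hη⟩ := (Module.Baer.of_divisible D).extension_property_addMonoidHom
    (QuotientAddGroup.kerLift p) (QuotientAddGroup.kerLift_injective p)
    (QuotientAddGroup.lift p.ker χ h)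
  exact ⟨η, fun x => DFunLike.congr_fun hη (x : G ⧸ p.ker)⟩

theorem exists_extension_of_injective {B A D : Type*} [AddCommGroup B] [AddCommGroup A]
    [AddCommGroup D] [DivisibleBy D ℤ] (i : B →+ A) (hi : Function.Injective i) (χ : B →+ D) :
    ∃ η : A →+ D, ∀ x, η (i x) = χ x :=
  exists_factor_of_ker_le i χ fun x hx => by
    rw [(injective_iff_map_eq_zero i).1 hi x hx, map_zero]

/-! ### Vanishing of Ext as lifting of characters -/

section Ext

open CategoryTheory CategoryTheory.Abelian

/-- The short exact sequence `0 → ℤ → ℚ → ℚ / ℤ → 0`. -/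
noncomputable def intRatSequence : ShortComplex (ModuleCat.{0} ℤ) where
  X₁ := ModuleCat.of ℤ ℤ
  X₂ := ModuleCat.of ℤ ℚ
  X₃ := ModuleCat.of ℤ RatModInt
  f := ModuleCat.ofHom (Int.castAddHom ℚ).toIntLinearMap
  g := ModuleCat.ofHom (QuotientAddGroup.mk' (AddSubgroup.zmultiples (1 : ℚ))).toIntLinearMap
  zero := by
    ext
    exact (ratModInt_coe_eq_zero_iff _).2 ⟨1, rfl⟩

theorem intRatSequence_shortExact : intRatSequence.ShortExact where
  exact := by
    rw [ShortComplex.moduleCat_exact_iff]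
    intro x hx
    exact (ratModInt_coe_eq_zero_iff x).1 hx
  mono_f := by
    rw [ModuleCat.mono_iff_injective]
    exact (Int.cast_injective : Function.Injective (Int.cast : ℤ → ℚ))
  epi_g := by
    rw [ModuleCat.epi_iff_surjective]
    exact QuotientAddGroup.mk'_surjective (AddSubgroup.zmultiples (1 : ℚ))

/-- In the long exact sequence of `0 → ℤ → ℚ → ℚ / ℤ → 0`, injectivity of `ℚ` makes `Ext¹(A, ℤ)` the
cokernel of `Hom(A, ℚ) → Hom(A, ℚ / ℤ)`. -/
theorem isWhitehead_iff_liftsCharacters (A : Type) [AddCommGroup A] :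
    IsWhitehead A ↔ LiftsCharacters A := by
  have hQ : Injective intRatSequence.X₂ :=
    Module.injective_object_of_injective_module (R := ℤ) (M := ℚ)
      (inj := (Module.Baer.of_divisible ℚ).injective)
  constructor
  · intro hA χ
    have hA : Subsingleton (Ext (ModuleCat.of ℤ A) intRatSequence.X₁ 1) := hA
    obtain ⟨y, hy⟩ := Ext.covariant_sequence_exact₃ (ModuleCat.of ℤ A) intRatSequence_shortExact
      (Ext.mk₀ (ModuleCat.ofHom χ.toIntLinearMap : ModuleCat.of ℤ A ⟶ intRatSequence.X₃))
      (zero_add 1) (Subsingleton.elim _ _)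
    obtain ⟨f, rfl⟩ := (Ext.mk₀_bijective _ _).2 y
    rw [Ext.mk₀_comp_mk₀] at hy
    have hf := (Ext.mk₀_bijective _ _).1 hy
    exact ⟨f.hom.toAddMonoidHom, fun a => congr($hf a)⟩
  · intro hA
    refine subsingleton_of_forall_eq 0 fun x => ?_
    change Ext (ModuleCat.of ℤ A) intRatSequence.X₁ 1 at x
    obtain ⟨y, rfl⟩ := Ext.covariant_sequence_exact₁ (ModuleCat.of ℤ A) intRatSequence_shortExact
      x (Ext.eq_zero_of_injective _) (zero_add 1)
    obtain ⟨χ, rfl⟩ := (Ext.mk₀_bijective _ _).2 y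
    obtain ⟨f, hf⟩ := hA χ.hom.toAddMonoidHom
    obtain ⟨φ, rfl⟩ : ∃ φ : ModuleCat.of ℤ A ⟶ intRatSequence.X₂, φ ≫ intRatSequence.g = χ :=
      ⟨ModuleCat.ofHom f.toIntLinearMap, by ext a; exact hf a⟩
    rw [ ← Ext.mk₀_comp_mk₀, Ext.comp_assoc_of_second_deg_zero,
      intRatSequence_shortExact.comp_extClass, Ext.comp_zero]
    rfl

end Ext

namespace LiftsCharacters

variable {A B : Type} [AddCommGroup A] [AddCommGroup B]

theorem of_injective (hA : LiftsCharacters A) (i : B →+ A) (hi : Function.Injective i) :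
    LiftsCharacters B := by
  intro χ
  obtain ⟨η, hη⟩ := exists_extension_of_injective i hi χ
  obtain ⟨f, hf⟩ := hA η
  exact ⟨f.comp i, fun b => by simp [hf, hη]⟩

/-- Characters separate points, but one that factors through `ℚ` kills torsion. -/
theorem eq_zero_of_smul_eq_zero (hA : LiftsCharacters A) {n : ℤ} (hn : n ≠ 0) {a : A}
    (ha : n • a = 0) : a = 0 := by
  refine CharacterModule.eq_zero_of_character_apply fun c => ?_
  obtain ⟨f, hf⟩ := hA c
  have h0 : n • f a = 0 := by rw [← map_zsmul, ha, map_zero]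
  have h1 : f a = 0 := (smul_eq_zero.1 h0).resolve_left hn
  exact (hf a).symm.trans (by rw [h1]; rfl)

end LiftsCharacters

/-! ### Pure closures and Stein's theorem -/

/-- The pure closure of a subgroup: all elements having a nonzero multiple in it. -/
def AddSubgroup.isolator {A : Type*} [AddCommGroup A] (L : AddSubgroup A) : AddSubgroup A where
  carrier := {x | ∃ n : ℤ, n ≠ 0 ∧ n • x ∈ L}
  zero_mem' := ⟨1, one_ne_zero, by simp⟩
  add_mem' := by
    rintro x y ⟨m, hm, hx⟩ ⟨n, hn, hy⟩
    refine ⟨m * n, mul_ne_zero hm hn, ?_⟩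
    rw [smul_add]
    refine L.add_mem ?_ ?_
    · rw [mul_comm, mul_smul]; exact L.zsmul_mem hx n
    · rw [mul_smul]; exact L.zsmul_mem hy m
  neg_mem' := by
    rintro x ⟨n, hn, hx⟩
    exact ⟨n, hn, by rw [smul_neg]; exact L.neg_mem hx⟩

namespace AddSubgroup

variable {A : Type*} [AddCommGroup A]

theorem le_isolator (L : AddSubgroup A) : L ≤ L.isolator :=
  fun x hx => ⟨1, one_ne_zero, by simpa using hx⟩

theorem isolator_mono {L L' : AddSubgroup A} (h : L ≤ L') : L.isolator ≤ L'.isolator := by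
  rintro x ⟨n, hn, hx⟩
  exact ⟨n, hn, h hx⟩

theorem isolator_isolator_le (L : AddSubgroup A) : L.isolator.isolator ≤ L.isolator := by
  rintro x ⟨n, hn, m, hm, hx⟩
  exact ⟨m * n, mul_ne_zero hm hn, by rwa [mul_smul]⟩

end AddSubgroup

/-- In a countable abelian group that is not finitely generated, no sequence exhausts the
characters. -/
theorem exists_character_ne {N : Type} [AddCommGroup N] [Countable N] (hN : ¬ AddGroup.FG N)
    (f : ℕ → N →+ RatModInt) : ∃ χ : N →+ RatModInt, ∀ i, χ ≠ f i := by
  obtain ⟨x, hx⟩ := exists_surjective_nat N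
  -- Diagonal argument. A state is a finitely generated subgroup with a character of all of `N`, of
  -- which only the restriction to the subgroup is kept. Step `i` absorbs `x i` and forces
  -- disagreement with `f i`.
  have step : ∀ (i : ℕ) (p : {p : AddSubgroup N × (N →+ RatModInt) // p.1.FG}),
      ∃ p' : {p : AddSubgroup N × (N →+ RatModInt) // p.1.FG},
        p.1.1 ≤ p'.1.1 ∧ x i ∈ p'.1.1 ∧ (∀ y ∈ p.1.1, p'.1.2 y = p.1.2 y) ∧
          ∃ y ∈ p'.1.1, p'.1.2 y ≠ f i y := by
    rintro i ⟨⟨P, χ⟩, hP⟩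
    change P.FG at hP
    have hne : P ≠ ⊤ := fun h => hN (AddGroup.fg_def.2 (h ▸ hP))
    obtain ⟨z, hz⟩ : ∃ z, z ∉ P := by
      by_contra! h
      exact hne (eq_top_iff.2 fun z _ => h z)
    have hz' : (z : N ⧸ P) ≠ 0 := fun h => hz ((QuotientAddGroup.eq_zero_iff z).1 h)
    obtain ⟨c, hc⟩ := CharacterModule.exists_character_apply_ne_zero_of_ne_zero hz'
    let η : N →+ RatModInt := AddMonoidHom.comp c (QuotientAddGroup.mk' P)
    have hη : ∀ y ∈ P, η y = 0 := fun y hy => by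
      have : ((y : N) : N ⧸ P) = 0 := (QuotientAddGroup.eq_zero_iff y).2 hy
      change c (y : N ⧸ P) = 0
      rw [this, map_zero]
    have key : ∃ χ' : N →+ RatModInt, (∀ y ∈ P, χ' y = χ y) ∧ ∃ y, χ' y ≠ f i y := by
      by_cases h : χ = f i
      · refine ⟨χ + η, fun y hy => by simp [hη y hy], z, ?_⟩
        rw [← h]
        have : η z ≠ 0 := hc
        simpa using this
      · exact ⟨χ, fun _ _ => rfl, by by_contra! h'; exact h (AddMonoidHom.ext h')⟩
    obtain ⟨χ', h1, y, hy⟩ := key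
    refine ⟨⟨⟨P ⊔ AddSubgroup.closure {x i, y}, χ'⟩,
      hP.sup ((AddSubgroup.fg_iff _).2 ⟨{x i, y}, rfl, by simp⟩)⟩, le_sup_left, ?_, h1, y, ?_, hy⟩
    · exact (le_sup_right : _ ≤ P ⊔ _) (AddSubgroup.subset_closure (by simp))
    · exact (le_sup_right : _ ≤ P ⊔ _) (AddSubgroup.subset_closure (by simp))
  choose next hle hmem hext hne using step
  let s : ℕ → {p : AddSubgroup N × (N →+ RatModInt) // p.1.FG} :=
    fun n => Nat.rec ⟨⟨⊥, 0⟩, ⟨∅, by simp⟩⟩ next n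
  have hs : ∀ n, s (n + 1) = next n (s n) := fun n => rfl
  have hmono : ∀ i j, i ≤ j → (s i).1.1 ≤ (s j).1.1 ∧ ∀ y ∈ (s i).1.1, (s j).1.2 y = (s i).1.2 y := by
    intro i j hij
    induction j, hij using Nat.le_induction with
    | base => exact ⟨le_rfl, fun _ _ => rfl⟩
    | succ j _ ih =>
      rw [hs]
      exact ⟨ih.1.trans (hle _ _), fun y hy => (hext j _ y (ih.1 hy)).trans (ih.2 y hy)⟩
  have hall : ∀ y, ∃ k, y ∈ (s k).1.1 := fun y => by
    obtain ⟨i, rfl⟩ := hx y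
    exact ⟨i + 1, hmem i (s i)⟩
  choose k hk using hall
  have hval : ∀ y j, y ∈ (s j).1.1 → (s (k y)).1.2 y = (s j).1.2 y := by
    intro y j hy
    rcases le_total (k y) j with h | h
    · exact ((hmono _ _ h).2 y (hk y)).symm
    · exact (hmono _ _ h).2 y hy
  refine ⟨AddMonoidHom.mk' (fun y => (s (k y)).1.2 y) fun a b => ?_, fun i h => ?_⟩
  · have ha := (hmono (k a) (max (k a) (k b)) (le_max_left _ _)).1 (hk a)
    have hb := (hmono (k b) (max (k a) (k b)) (le_max_right _ _)).1 (hk b)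
    change (s (k (a + b))).1.2 (a + b) = (s (k a)).1.2 a + (s (k b)).1.2 b
    rw [hval _ _ ha, hval _ _ hb, hval _ _ (add_mem ha hb), map_add]
  · obtain ⟨y, hy, hyne⟩ := hne i (s i)
    exact hyne ((hval y (i + 1) hy).symm.trans (DFunLike.congr_fun h y))

/-- A countable group of finite rank all of whose characters lift is finitely generated. -/
theorem LiftsCharacters.fg_of_isolator_eq_top {N : Type} [AddCommGroup N] [Countable N]
    (hN : LiftsCharacters N) (S : Set N) (hS : S.Finite)
    (hiso : (AddSubgroup.closure S).isolator = ⊤) : AddGroup.FG N := by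
  by_contra hfg
  choose lift hlift using hN
  have := hS.to_subtype
  -- Every element has a nonzero multiple in the span of `S`, so a lift is determined by its values
  -- on the finite set `S`. This leaves only countably many characters.
  have hinj : Function.Injective fun (χ : N →+ RatModInt) (s : S) => lift χ s := by
    intro χ χ' h
    have h1 : AddSubgroup.closure S ≤ (lift χ - lift χ').ker := by
      rw [AddSubgroup.closure_le]
      intro s hs
      have := congrFun h ⟨s, hs⟩
      simpa [AddMonoidHom.mem_ker, sub_eq_zero] using this
    have h2 : ∀ x, lift χ x = lift χ' x := by
      intro x
      obtain ⟨n, hn, hx⟩ : x ∈ (AddSubgroup.closure S).isolator := hiso ▸ AddSubgroup.mem_top x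
      have h3 : n • (lift χ - lift χ') x = 0 := by
        rw [← map_zsmul]
        exact h1 hx
      exact sub_eq_zero.1 ((smul_eq_zero.1 h3).resolve_left hn)
    ext x
    rw [← hlift χ, ← hlift χ', h2]
  have hc : Countable (N →+ RatModInt) := hinj.countable
  obtain ⟨f, hf⟩ := exists_surjective_nat (N →+ RatModInt)
  obtain ⟨χ, hχ⟩ := exists_character_ne hfg f
  obtain ⟨i, hi⟩ := hf χ
  exact hχ i hi.symm

/-- A module that is the union of an increasing sequence of submodules, each a direct summand with
free complement in the next one, is free. -/
theorem Module.Free.of_nat_chain {M : Type*} [AddCommGroup M] (P : ℕ → Submodule ℤ M)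
    (h0 : P 0 = ⊥) (hexh : ∀ x, ∃ n, x ∈ P n) (Q : ℕ → Submodule ℤ M)
    (hfree : ∀ n, Module.Free ℤ (Q n)) (hdisj : ∀ n, Disjoint (P n) (Q n))
    (hsup : ∀ n, P n ⊔ Q n = P (n + 1)) : Module.Free ℤ M := by
  classical
  have hmono : Monotone P := monotone_nat_of_le_succ fun n => hsup n ▸ le_sup_left
  have hQ : ∀ {i n}, i < n → Q i ≤ P n := fun {i n} h =>
    (le_sup_right.trans (hsup i).le).trans (hmono h)
  have hint : DirectSum.IsInternal Q := by
    rw [DirectSum.isInternal_submodule_iff_iSupIndep_and_iSup_eq_top]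
    constructor
    · rw [iSupIndep_iff_finsetSum_eq_zero_imp_eq_zero]
      intro s
      induction s using Finset.induction_on_max with
      | empty => simp
      | insert n s hlt ih =>
        intro v hvQ hv
        rw [Finset.sum_insert fun h => (hlt n h).false] at hv
        have hsum : ∑ i ∈ s, v i ∈ P n :=
          Submodule.sum_mem _ fun i hi => hQ (hlt i hi) (hvQ i (Finset.mem_insert_of_mem hi))
        have hn : v n ∈ P n := by
          rw [eq_neg_of_add_eq_zero_left hv]
          exact neg_mem hsum
        have hn0 : v n = 0 := Submodule.disjoint_def.1 (hdisj n) _ hn (hvQ n (Finset.mem_insert_self _ _))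
        rw [hn0, zero_add] at hv
        intro i hi
        rcases Finset.mem_insert.1 hi with rfl | hi
        · exact hn0
        · exact ih v (fun j hj => hvQ j (Finset.mem_insert_of_mem hj)) hv i hi
    · rw [eq_top_iff]
      rintro x -
      obtain ⟨n, hn⟩ := hexh x
      have : ∀ n, P n ≤ ⨆ i, Q i := by
        intro n
        induction n with
        | zero => simp [h0]
        | succ n ih => rw [← hsup]; exact sup_le ih (le_iSup _ n)
      exact this n hn
  exact Module.Free.of_equiv (LinearEquiv.ofBijective (DirectSum.coeLinearMap Q) hint)

/-- **Stein's theorem**: a countable abelian group all of whose characters lift to `ℚ` is free. -/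
theorem LiftsCharacters.free {M : Type} [AddCommGroup M] [Countable M] (hM : LiftsCharacters M) :
    Module.Free ℤ M := by
  obtain ⟨x, hx⟩ := exists_surjective_nat M
  let S : ℕ → Set M := fun n => x '' Set.Iio n
  let P : ℕ → Submodule ℤ M := fun n =>
    AddSubgroup.toIntSubmodule (AddSubgroup.closure (S n)).isolator
  have hP : ∀ n y, y ∈ P n ↔ y ∈ (AddSubgroup.closure (S n)).isolator := fun n y => Iff.rfl
  have hmono : ∀ n, P n ≤ P (n + 1) := fun n y hy =>
    AddSubgroup.isolator_mono (AddSubgroup.closure_mono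
      (Set.image_mono (Set.Iio_subset_Iio n.le_succ))) hy
  have hfin : ∀ n, Module.Finite ℤ (P n) := by
    intro n
    have hlift : LiftsCharacters (P n) :=
      hM.of_injective (P n).subtype.toAddMonoidHom Subtype.val_injective
    have hsub : S n ⊆ P n := fun y hy =>
      AddSubgroup.le_isolator _ (AddSubgroup.subset_closure hy)
    have hfg : AddGroup.FG (P n) := by
      refine hlift.fg_of_isolator_eq_top (Subtype.val ⁻¹' S n)
        (((Set.finite_Iio n).image x).preimage Subtype.val_injective.injOn) ?_
      rw [eq_top_iff]
      rintro ⟨y, m, hm, hy⟩ -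
      refine ⟨m, hm, ?_⟩
      have hmap : (AddSubgroup.closure (Subtype.val ⁻¹' S n : Set (P n))).map
          (P n).subtype.toAddMonoidHom = AddSubgroup.closure (S n) := by
        rw [AddMonoidHom.map_closure]
        congr 1
        exact Subtype.image_preimage_val (P n : Set M) (S n) |>.trans
          (Set.inter_eq_right.2 hsub)
      rw [← hmap] at hy
      obtain ⟨z, hz, hzy⟩ := hy
      have : z = m • ⟨y, m, hm, hmap ▸ ⟨z, hz, hzy⟩⟩ := Subtype.ext hzy
      exact this ▸ hz
    exact Module.Finite.iff_addGroup_fg.2 hfg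
  -- `P (n + 1) / P n` is finitely generated, and torsion-free because `P n` is pure; hence it is
  -- free and splits off.
  have hcompl : ∀ n, ∃ Q : Submodule ℤ M, Module.Free ℤ Q ∧ Disjoint (P n) Q ∧
      P n ⊔ Q = P (n + 1) := by
    intro n
    let P' : Submodule ℤ (P (n + 1)) := (P n).comap (P (n + 1)).subtype
    have htf : Module.IsTorsionFree ℤ (P (n + 1) ⧸ P') := by
      rw [Module.isTorsionFree_iff_smul_eq_zero]
      intro m y hy
      obtain ⟨y, rfl⟩ := Submodule.Quotient.mk_surjective _ y
      rw [← Submodule.Quotient.mk_smul, Submodule.Quotient.mk_eq_zero] at hy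
      by_cases hm : m = 0
      · exact Or.inl hm
      · refine Or.inr ((Submodule.Quotient.mk_eq_zero _).2 ?_)
        exact AddSubgroup.isolator_isolator_le _ ⟨m, hm, hy⟩
    obtain ⟨s, hs⟩ := P'.mkQ.exists_rightInverse_of_surjective (Submodule.range_mkQ _)
    have hs' : ∀ q, P'.mkQ (s q) = q := fun q => LinearMap.congr_fun hs q
    have hinj : Function.Injective ((P (n + 1)).subtype ∘ₗ s) :=
      Subtype.val_injective.comp (Function.LeftInverse.injective hs')
    refine ⟨LinearMap.range ((P (n + 1)).subtype ∘ₗ s),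
      Module.Free.of_equiv (LinearEquiv.ofInjective _ hinj), ?_, ?_⟩
    · rw [Submodule.disjoint_def]
      rintro _ hy ⟨q, rfl⟩
      have : P'.mkQ (s q) = 0 := (Submodule.Quotient.mk_eq_zero _).2 hy
      rw [hs'] at this
      rw [this, map_zero]
    · apply le_antisymm
      · refine sup_le (hmono n) ?_
        rintro _ ⟨q, rfl⟩
        exact (s q).2
      · intro y hy
        have h1 : (⟨y, hy⟩ : P (n + 1)) - s (P'.mkQ ⟨y, hy⟩) ∈ P' := by
          rw [← Submodule.Quotient.mk_eq_zero, Submodule.Quotient.mk_sub, sub_eq_zero]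
          exact (hs' _).symm
        refine Submodule.mem_sup.2 ⟨_, h1, _, ⟨P'.mkQ ⟨y, hy⟩, rfl⟩, ?_⟩
        simp
  choose Q hQ using hcompl
  refine Module.Free.of_nat_chain P ?_ ?_ Q (fun n => (hQ n).1) (fun n => (hQ n).2.1)
    fun n => (hQ n).2.2
  · rw [eq_bot_iff]
    rintro y ⟨m, hm, hy⟩
    have : m • y = 0 := by simpa [S] using hy
    exact hM.eq_zero_of_smul_eq_zero hm this
  · intro y
    obtain ⟨n, rfl⟩ := hx y
    exact ⟨n + 1, AddSubgroup.le_isolator _ (AddSubgroup.subset_closure ⟨n, by simp, rfl⟩)⟩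

theorem LiftsCharacters.countable_isolator {A : Type} [AddCommGroup A] (hA : LiftsCharacters A)
    (L : AddSubgroup A) [Countable L] : Countable L.isolator := by
  choose n hn hx using fun x : L.isolator => x.2
  refine Function.Injective.countable (f := fun x => ((n x, ⟨_, hx x⟩) : ℤ × L)) fun x y h => ?_
  have h1 : n x = n y := congrArg Prod.fst h
  have h2 : n x • (x : A) = n y • (y : A) := congrArg (fun p : ℤ × L => (p.2 : A)) h
  rw [← h1, ← sub_eq_zero, ← smul_sub] at h2
  exact Subtype.ext (sub_eq_zero.1 (hA.eq_zero_of_smul_eq_zero (hn x) h2))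

/-! ### Non-liftable characters along a filtration -/

/-- If `S / P` is countable and not free and `P` is pure in `A`, then for every `v ≠ 0` there is a
character `χ` of `A / P` such that `v • χ` has no lift to `ℚ` over `S / P`. -/
theorem exists_character_smul_not_lift {A : Type} [AddCommGroup A] {P S : AddSubgroup A}
    [Countable S] (hP : P.isolator ≤ P) (hPS : ¬ Module.Free ℤ (S ⧸ P.addSubgroupOf S))
    {v : ℤ} (hv : v ≠ 0) :
    ∃ χ : A →+ RatModInt, (∀ a ∈ P, χ a = 0) ∧
      ¬ ∃ μ : A →+ ℚ, (∀ a ∈ P, μ a = 0) ∧ ∀ a ∈ S, (μ a : RatModInt) = v • χ a := by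
  have : Countable (S ⧸ P.addSubgroupOf S) := (QuotientAddGroup.mk_surjective).countable
  have hlift : ¬ LiftsCharacters (S ⧸ P.addSubgroupOf S) := fun h => hPS h.free
  unfold LiftsCharacters at hlift
  push Not at hlift
  obtain ⟨χ₀, hχ₀⟩ := hlift
  have hmk : ∀ a (ha : a ∈ S), a ∈ P → ((⟨a, ha⟩ : S) : S ⧸ P.addSubgroupOf S) = 0 :=
    fun a ha haP => (QuotientAddGroup.eq_zero_iff _).2 haP
  obtain ⟨χ₁, hχ₁⟩ := exists_factor_of_ker_le ((QuotientAddGroup.mk' P).comp S.subtype)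
    (χ₀.comp (QuotientAddGroup.mk' (P.addSubgroupOf S))) (by
      rintro ⟨a, ha⟩ h
      have : a ∈ P := (QuotientAddGroup.eq_zero_iff a).1 h
      change χ₀ ((⟨a, ha⟩ : S) : S ⧸ P.addSubgroupOf S) = 0
      rw [hmk a ha this, map_zero])
  -- Purity makes multiplication by `v` injective on `A / P`, so `χ₁` can be divided by `v`.
  obtain ⟨η, hη⟩ := exists_factor_of_ker_le (v • (AddMonoidHom.id (A ⧸ P))) χ₁ (by
      intro x hx
      obtain ⟨a, rfl⟩ := QuotientAddGroup.mk_surjective x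
      have h1 : ((v • a : A) : A ⧸ P) = 0 := hx
      have h2 : a ∈ P := hP ⟨v, hv, (QuotientAddGroup.eq_zero_iff _).1 h1⟩
      rw [(QuotientAddGroup.eq_zero_iff a).2 h2, map_zero])
  refine ⟨η.comp (QuotientAddGroup.mk' P), fun a ha => ?_, ?_⟩
  · have : ((a : A) : A ⧸ P) = 0 := (QuotientAddGroup.eq_zero_iff a).2 ha
    change η (a : A ⧸ P) = 0
    rw [this, map_zero]
  · rintro ⟨μ, hμ0, hμ⟩
    obtain ⟨x, hx⟩ := hχ₀ (QuotientAddGroup.lift _ (μ.comp S.subtype) fun s hs => hμ0 s hs)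
    obtain ⟨⟨a, ha⟩, rfl⟩ := QuotientAddGroup.mk_surjective x
    refine hx ?_
    have h1 : η (v • (a : A ⧸ P)) = χ₁ (a : A ⧸ P) := hη (a : A ⧸ P)
    have h2 : χ₁ (a : A ⧸ P) = χ₀ ((⟨a, ha⟩ : S) : S ⧸ P.addSubgroupOf S) := hχ₁ ⟨a, ha⟩
    rw [← h2, ← h1, map_zsmul]
    exact hμ a ha

namespace IsCountableFiltration

variable {A : Type} [AddCommGroup A] {C : Ordinal.{0} → AddSubgroup A}

theorem succ_lt_omega_one {α : Ordinal.{0}} (h : α < ω₁) : α + 1 < ω₁ := by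
  have := (Cardinal.isSuccLimit_omega 1).succ_lt h
  rwa [Order.succ_eq_add_one] at this

theorem exists_isolator_le (hC : IsCountableFiltration C) (hA : LiftsCharacters A)
    {β : Ordinal.{0}} (hβ : β < ω₁) : ∃ γ, β < γ ∧ γ < ω₁ ∧ (C β).isolator ≤ C γ := by
  have := hC.countable β hβ
  have := hA.countable_isolator (C β)
  choose g hg hmem using hC.exhaust
  have hsup : ⨆ x : (C β).isolator, g x < ω₁ := Ordinal.iSup_lt_omega_one fun x => hg x
  refine ⟨max (β + 1) (⨆ x : (C β).isolator, g x), ?_, max_lt (succ_lt_omega_one hβ) hsup, ?_⟩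
  · exact lt_of_lt_of_le (Order.lt_add_one_iff.2 le_rfl) (le_max_left _ _)
  · intro x hx
    refine hC.mono _ _ ?_ (max_lt (succ_lt_omega_one hβ) hsup) (hmem x)
    exact (Ordinal.le_iSup (fun x : (C β).isolator => g x) ⟨x, hx⟩).trans (le_max_right _ _)

/-- The limit ordinals `δ < ω₁` at which the filtration is pure are unbounded in `ω₁`. -/
theorem exists_limit_isolator_le (hC : IsCountableFiltration C) (hA : LiftsCharacters A)
    {α : Ordinal.{0}} (hα : α < ω₁) :
    ∃ δ, α ≤ δ ∧ Order.IsSuccLimit δ ∧ δ < ω₁ ∧ (C δ).isolator ≤ C δ := by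
  choose! g hlt hg hiso using fun β hβ => hC.exists_isolator_le hA (β := β) hβ
  let s : ℕ → Ordinal.{0} := fun n => g^[n] α
  have hs : ∀ n, s (n + 1) = g (s n) := fun n => Function.iterate_succ_apply' g n α
  have hsω : ∀ n, s n < ω₁ := by
    intro n
    induction n with
    | zero => exact hα
    | succ n ih => rw [hs]; exact hg _ ih
  have hle : ∀ n, s n ≤ ⨆ n, s n := Ordinal.le_iSup s
  have hltδ : ∀ n, s n < ⨆ n, s n := fun n =>
    lt_of_lt_of_le (by rw [hs]; exact hlt _ (hsω n)) (hle (n + 1))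
  have hδ : ⨆ n, s n < ω₁ := Ordinal.iSup_lt_omega_one hsω
  have hlim : Order.IsSuccLimit (⨆ n, s n) := by
    refine ⟨fun h => (hltδ 0).not_ge (h (hltδ 0).le), fun β hβ => ?_⟩
    obtain ⟨n, hn⟩ := Ordinal.lt_iSup_iff.1 hβ.lt
    exact hβ.2 hn (hltδ n)
  refine ⟨⨆ n, s n, hle 0, hlim, hδ, ?_⟩
  rintro x ⟨m, hm, hx⟩
  obtain ⟨β, hβ, hxβ⟩ := hC.continuous _ hlim hδ _ hx
  obtain ⟨n, hn⟩ := Ordinal.lt_iSup_iff.1 hβ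
  have h1 : x ∈ C (g (s n)) := hiso _ (hsω n) ⟨m, hm, hC.mono _ _ hn.le (hsω n) hxβ⟩
  rw [← hs] at h1
  exact hC.mono _ _ (hle (n + 1)) hδ h1

/-- A Whitehead group with `Γ(A) = 1` has a filtration such that every proper step carries
characters whose multiples do not lift to `ℚ`. -/
theorem exists_character_filtration (hC : IsCountableFiltration C) (hA : LiftsCharacters A)
    (hfree : ∀ α, Order.IsSuccLimit α → α < ω₁ →
      ¬ Module.Free ℤ (C (α + 1) ⧸ (C α).addSubgroupOf (C (α + 1)))) :
    ∃ C' : Ordinal.{0} → AddSubgroup A, IsCountableFiltration C' ∧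
      ∀ α < ω₁, ¬ C' (α + 1) ≤ C' α → ∀ v : ℤ, v ≠ 0 →
        ∃ χ : A →+ RatModInt, (∀ a ∈ C' α, χ a = 0) ∧
          ¬ ∃ μ : A →+ ℚ, (∀ a ∈ C' α, μ a = 0) ∧
            ∀ a ∈ C' (α + 1), (μ a : RatModInt) = v • χ a := by
  let D : Set Ordinal.{0} := {δ | Order.IsSuccLimit δ ∧ δ < ω₁ ∧ (C δ).isolator ≤ C δ}
  -- Stage `α` is replaced by the first pure limit stage at or above `α`, so the new chain is
  -- constant except at steps starting in `D`.
  let g : Ordinal.{0} → Ordinal.{0} := fun α => sInf {δ | δ ∈ D ∧ α ≤ δ}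
  have hg : ∀ α < ω₁, g α ∈ D ∧ α ≤ g α := by
    intro α hα
    obtain ⟨δ, h1, h2⟩ := hC.exists_limit_isolator_le hA hα
    exact csInf_mem (s := {δ | δ ∈ D ∧ α ≤ δ}) ⟨δ, h2, h1⟩
  have hgle : ∀ {α δ}, δ ∈ D → α ≤ δ → g α ≤ δ := fun {α δ} h1 h2 =>
    csInf_le' (s := {δ | δ ∈ D ∧ α ≤ δ}) ⟨h1, h2⟩
  have hgω : ∀ α < ω₁, g α < ω₁ := fun α hα => (hg α hα).1.2.1
  refine ⟨fun α => C (g α), ⟨fun α hα => hC.countable _ (hgω α hα), fun α β hαβ hβ => ?_, ?_, ?_⟩, ?_⟩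
  · exact hC.mono _ _ (hgle (hg β hβ).1 (hαβ.trans (hg β hβ).2)) (hgω β hβ)
  · intro δ hlim hδ a ha
    by_cases hδD : δ ∈ D
    · rw [le_antisymm (hgle hδD le_rfl) (hg δ hδ).2] at ha
      obtain ⟨α, hα, haα⟩ := hC.continuous δ hlim hδ a ha
      exact ⟨α, hα, hC.mono _ _ (hg α (hα.trans hδ)).2 (hgω α (hα.trans hδ)) haα⟩
    -- `D` is closed under limits: a union of pure stages is pure. So a limit outside `D` lies above
    -- a gap of `D`, on which `g` is constant.
    · obtain ⟨α, hα, hgap⟩ : ∃ α < δ, ∀ ε ∈ D, α ≤ ε → δ ≤ ε := by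
        by_contra! hcon
        refine hδD ⟨hlim, hδ, ?_⟩
        rintro x ⟨m, hm, hx⟩
        obtain ⟨β, hβ, hxβ⟩ := hC.continuous δ hlim hδ _ hx
        obtain ⟨ε, hε, hβε, hεδ⟩ := hcon β hβ
        exact hC.mono _ _ hεδ.le hδ (hε.2.2 ⟨m, hm, hC.mono _ _ hβε hε.2.1 hxβ⟩)
      have hα' := hα.trans hδ
      exact ⟨α, hα, hC.mono _ _ (hgle (hg α hα').1 (hgap _ (hg α hα').1 (hg α hα').2))
        (hgω α hα') ha⟩
  · intro a
    obtain ⟨α, hα, ha⟩ := hC.exhaust a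
    exact ⟨α, hα, hC.mono _ _ (hg α hα).2 (hgω α hα) ha⟩
  · intro α hα hne v hv
    have hα1 := succ_lt_omega_one hα
    have hgα : g α = α := by
      by_contra h
      have hlt : α < g α := lt_of_le_of_ne (hg α hα).2 (Ne.symm h)
      exact hne (hC.mono _ _ (hgle (hg α hα).1 (Order.add_one_le_iff.2 hlt)) (hgω α hα))
    have hαD : α ∈ D := hgα ▸ (hg α hα).1
    have := hC.countable _ hα1
    obtain ⟨χ, hχ, hμ⟩ := exists_character_smul_not_lift hαD.2.2 (hfree α hαD.1 hα) hv
    refine ⟨χ, ?_, ?_⟩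
    · simpa only [hgα] using hχ
    · rintro ⟨μ, h1, h2⟩
      simp only [hgα] at h1
      exact hμ ⟨μ, h1, fun a ha => h2 a (hC.mono _ _ (hg _ hα1).2 (hgω _ hα1) ha)⟩

end IsCountableFiltration

/-! ### Gluing homomorphisms along a filtration -/

/-- Given homomorphisms `w α : A → W` vanishing on `C α`, a divisible filtration `Wf` of `W` admits
a homomorphism `θ : A → W` compatible with the filtrations that agrees with `w α` on `C (α + 1)`
modulo `Wf α`. -/
theorem IsCountableFiltration.exists_twisted_hom {A W : Type} [AddCommGroup A] [AddCommGroup W]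
    {C : Ordinal.{0} → AddSubgroup A} (hC : IsCountableFiltration C)
    (Wf : Ordinal.{0} → AddSubgroup W) (hmono : ∀ α β, α ≤ β → β < ω₁ → Wf α ≤ Wf β)
    (hdiv : ∀ α, ∀ n : ℤ, n ≠ 0 → ∀ x ∈ Wf α, ∃ y ∈ Wf α, n • y = x)
    (w : Ordinal.{0} → A →+ W) (hw0 : ∀ α < ω₁, ∀ a ∈ C α, w α a = 0)
    (hw : ∀ α < ω₁, ∀ a, w α a ∈ Wf (α + 1)) :
    ∃ θ : A →+ W, (∀ α < ω₁, ∀ a ∈ C α, θ a ∈ Wf α) ∧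
      ∀ α < ω₁, ∀ a ∈ C (α + 1), θ a - w α a ∈ Wf α := by
  -- Zorn's lemma replaces transfinite recursion. The first clause makes the domain a union of
  -- stages, so at the first stage it misses it lies strictly below.
  let Good : (A →ₗ.[ℤ] W) → Prop := fun f =>
    (∀ x ∈ f.domain, ∃ γ < ω₁, x ∈ C γ ∧ ∀ y ∈ C γ, y ∈ f.domain) ∧
    (∀ α < ω₁, ∀ x : f.domain, (x : A) ∈ C α → f x ∈ Wf α) ∧
    (∀ α < ω₁, ∀ x : f.domain, (x : A) ∈ C (α + 1) → f x - w α x ∈ Wf α)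
  have h0ω : (0 : Ordinal.{0}) < ω₁ := Ordinal.omega_pos 1
  have hbase : Good ⟨AddSubgroup.toIntSubmodule (C 0), 0⟩ := by
    refine ⟨fun x hx => ⟨0, h0ω, hx, fun y hy => hy⟩, fun α _ x _ => (Wf α).zero_mem,
      fun α hα x _ => ?_⟩
    rw [hw0 α hα x (hC.mono 0 α zero_le hα x.2)]
    simp
  obtain ⟨f, -, hf⟩ := zorn_le_nonempty₀ {f | Good f} (by
    intro c hcS hc g hg
    have hdir : DirectedOn (· ≤ ·) c := hc.directedOn
    refine ⟨LinearPMap.sSup c hdir, ⟨?_, ?_, ?_⟩, fun z hz => LinearPMap.le_sSup hdir hz⟩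
    · intro x hx
      obtain ⟨l, hl, hxl⟩ := (LinearPMap.mem_domain_sSup_iff ⟨g, hg⟩ hdir).1 hx
      obtain ⟨γ, hγ, hxγ, hle⟩ := (hcS hl).1 x hxl
      exact ⟨γ, hγ, hxγ, fun y hy => (LinearPMap.mem_domain_sSup_iff ⟨g, hg⟩ hdir).2
        ⟨l, hl, hle y hy⟩⟩
    · rintro α hα ⟨x, hx⟩ hxα
      obtain ⟨l, hl, hxl⟩ := (LinearPMap.mem_domain_sSup_iff ⟨g, hg⟩ hdir).1 hx
      have := (hcS hl).2.1 α hα ⟨x, hxl⟩ hxα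
      rwa [← LinearPMap.sSup_apply hdir hl] at this
    · rintro α hα ⟨x, hx⟩ hxα
      obtain ⟨l, hl, hxl⟩ := (LinearPMap.mem_domain_sSup_iff ⟨g, hg⟩ hdir).1 hx
      have := (hcS hl).2.2 α hα ⟨x, hxl⟩ hxα
      rwa [← LinearPMap.sSup_apply hdir hl] at this) _ hbase
  have hgood : Good f := hf.prop
  by_cases htop : ∀ α < ω₁, ∀ a ∈ C α, a ∈ f.domain
  · have hdom : ∀ a, a ∈ f.domain := fun a => by
      obtain ⟨α, hα, ha⟩ := hC.exhaust a
      exact htop α hα a ha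
    refine ⟨AddMonoidHom.mk' (fun a => f ⟨a, hdom a⟩) fun a b => ?_,
      fun α hα a ha => hgood.2.1 α hα ⟨a, _⟩ ha, fun α hα a ha => hgood.2.2 α hα ⟨a, _⟩ ha⟩
    rw [← f.map_add]
    rfl
  · exfalso
    have hex : ∃ α, α < ω₁ ∧ ¬ ∀ a ∈ C α, a ∈ f.domain := by
      by_contra! h
      exact htop h
    obtain ⟨α, ⟨hα, hnot⟩, hmin⟩ : ∃ α, (α < ω₁ ∧ ¬ ∀ a ∈ C α, a ∈ f.domain) ∧
        ∀ γ < α, ∀ a ∈ C γ, a ∈ f.domain := by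
      refine ⟨sInf {α | α < ω₁ ∧ ¬ ∀ a ∈ C α, a ∈ f.domain}, csInf_mem hex, fun γ hγ => ?_⟩
      by_contra hcon
      exact hγ.not_ge (csInf_le' ⟨hγ.trans (csInf_mem hex).1, hcon⟩)
    have hbelow : ∀ x ∈ f.domain, ∃ γ < α, x ∈ C γ := by
      intro x hx
      obtain ⟨γ, hγ, hxγ, hle⟩ := hgood.1 x hx
      refine ⟨γ, lt_of_not_ge fun h => hnot fun a ha => hle a (hC.mono _ _ h hγ ha), hxγ⟩
    rcases Ordinal.zero_or_succ_or_isSuccLimit α with rfl | ⟨γ, rfl⟩ | hlim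
    · obtain ⟨γ, hγ, -⟩ := hbelow 0 f.domain.zero_mem
      exact not_lt_zero hγ
    · rw [Order.succ_eq_add_one] at *
      have hγ1 : γ < γ + 1 := Order.lt_add_one_iff.2 le_rfl
      have hγ : γ < ω₁ := hγ1.trans hα
      have hdom : ∀ a ∈ C γ, a ∈ f.domain := hmin γ hγ1
      let : DivisibleBy (Wf γ) ℤ := divisibleByOfSMulRightSurj _ _ fun {n} hn x => by
        obtain ⟨y, hy, hyx⟩ := hdiv γ n hn x x.2
        exact ⟨⟨y, hy⟩, Subtype.ext hyx⟩
      let f₀ : C γ →+ Wf γ := AddMonoidHom.mk'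
        (fun a => ⟨f ⟨a, hdom a a.2⟩, hgood.2.1 γ hγ _ a.2⟩) fun a b => Subtype.ext
          (f.map_add ⟨a, hdom a a.2⟩ ⟨b, hdom b b.2⟩)
      obtain ⟨h, hh⟩ := exists_extension_of_injective (C γ).subtype Subtype.val_injective f₀
      -- The part `h`, which exists as `Wf γ` is divisible, continues `f` inside `Wf γ`; adding `w
      -- γ` changes nothing on `C γ` and gives the prescribed class on `C (γ + 1)`.
      let F : A →+ W := (Wf γ).subtype.comp h + w γ
      have hF : ∀ a, F a = h a + w γ a := fun a => rfl
      have hFf : ∀ a (ha : a ∈ C γ), F a = f ⟨a, hdom a ha⟩ := fun a ha => by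
        have : (h a : W) = f ⟨a, hdom a ha⟩ := congrArg Subtype.val (hh ⟨a, ha⟩)
        rw [hF, hw0 γ hγ a ha, add_zero, this]
      have hFmem : ∀ β, γ < β → β < ω₁ → ∀ a, F a ∈ Wf β := fun β hβ hβω a =>
        hmono _ _ (Order.add_one_le_iff.2 hβ) hβω
          (add_mem (hmono _ _ hγ1.le hα (h a).2) (hw γ hγ a))
      let f' : A →ₗ.[ℤ] W := ⟨AddSubgroup.toIntSubmodule (C (γ + 1)),
        F.toIntLinearMap ∘ₗ Submodule.subtype _⟩
      have hf' : ∀ x : f'.domain, f' x = F x := fun x => rfl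
      have hgood' : Good f' := by
        refine ⟨fun x hx => ⟨γ + 1, hα, hx, fun y hy => hy⟩, fun β hβ x hx => ?_,
          fun β hβ x hx => ?_⟩
        · rw [hf']
          rcases le_or_gt β γ with hle | hlt
          · have hxγ := hC.mono _ _ hle hγ hx
            rw [hFf x hxγ]
            exact hgood.2.1 β hβ _ hx
          · exact hFmem β hlt hβ x
        · rw [hf']
          rcases lt_trichotomy β γ with hlt | rfl | hlt
          · have hxγ := hC.mono _ _ (Order.add_one_le_iff.2 hlt) hγ hx
            rw [hFf x hxγ]
            exact hgood.2.2 β hβ _ hx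
          · rw [hF, add_sub_cancel_right]
            exact (h x).2
          · rw [hw0 β hβ x (hC.mono _ _ (Order.add_one_le_iff.2 hlt) hβ x.2), sub_zero]
            exact hFmem β hlt hβ x
      have hle : f ≤ f' := by
        have hγdom : ∀ x ∈ f.domain, x ∈ C γ := fun x hx => by
          obtain ⟨β, hβ, hxβ⟩ := hbelow x hx
          exact hC.mono _ _ (Order.lt_add_one_iff.1 hβ) hγ hxβ
        refine ⟨fun x hx => hC.mono _ _ hγ1.le hα (hγdom x hx), fun x y hxy => ?_⟩
        rw [hf', ← hxy]
        exact (hFf x (hγdom x x.2)).symm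
      exact hnot fun a ha => (hf.le_of_ge hgood' hle).1 ha
    · refine hnot fun a ha => ?_
      obtain ⟨γ, hγ, haγ⟩ := hC.continuous α hlim hα a ha
      exact hmin γ hγ a haγ

/-! ### Construction of the twisted tower -/

section TwistedTower

variable {A E : Type} [AddCommGroup A] [AddCommGroup E] [Module ℚ E]

/-- The rational span of the image of a subgroup `S` of `A` in a rational vector space. -/
def rationalHull (ι : A →+ E) (S : AddSubgroup A) : Submodule ℚ E where
  carrier := {x | ∃ n : ℤ, n ≠ 0 ∧ ∃ a ∈ S, n • x = ι a}
  zero_mem' := ⟨1, one_ne_zero, 0, S.zero_mem, by simp⟩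
  add_mem' := by
    rintro x y ⟨m, hm, a, ha, hx⟩ ⟨n, hn, b, hb, hy⟩
    refine ⟨m * n, mul_ne_zero hm hn, n • a + m • b,
      S.add_mem (S.zsmul_mem ha n) (S.zsmul_mem hb m), ?_⟩
    rw [map_add, map_zsmul, map_zsmul, ← hx, ← hy, smul_add, mul_smul, mul_smul, smul_comm m n x]
  smul_mem' := by
    rintro q x ⟨n, hn, a, ha, hx⟩
    refine ⟨q.den * n, mul_ne_zero (by exact_mod_cast q.den_nz) hn, q.num • a,
      S.zsmul_mem ha _, ?_⟩
    rw [map_zsmul, ← hx, ← Int.cast_smul_eq_zsmul ℚ, ← Int.cast_smul_eq_zsmul ℚ q.num,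
      ← Int.cast_smul_eq_zsmul ℚ n, smul_smul, smul_smul]
    congr 1
    push_cast
    rw [mul_right_comm, Rat.den_mul_eq_num]

theorem rationalHull_mono (ι : A →+ E) {S T : AddSubgroup A} (h : S ≤ T) :
    rationalHull ι S ≤ rationalHull ι T := by
  rintro x ⟨n, hn, a, ha, hx⟩
  exact ⟨n, hn, a, h ha, hx⟩

theorem mem_rationalHull (ι : A →+ E) {S : AddSubgroup A} {a : A} (ha : a ∈ S) :
    ι a ∈ rationalHull ι S := ⟨1, one_ne_zero, a, ha, by simp⟩

theorem eq_inv_smul_of_zsmul_eq {n : ℤ} (hn : n ≠ 0) {x y : E} (h : n • x = y) :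
    x = (n : ℚ)⁻¹ • y := by
  rw [← h, ← Int.cast_smul_eq_zsmul ℚ, smul_smul, inv_mul_cancel₀ (by exact_mod_cast hn), one_smul]

instance (ι : A →+ E) (S : AddSubgroup A) [Countable S] : Countable (rationalHull ι S) := by
  have : Set.Countable (Set.range fun p : ℤ × S => (p.1 : ℚ)⁻¹ • ι p.2) := Set.countable_range _
  refine this.mono ?_ |>.to_subtype
  rintro x ⟨n, hn, a, ha, hx⟩
  exact ⟨(n, ⟨a, ha⟩), (eq_inv_smul_of_zsmul_eq hn hx).symm⟩

/-- The finitely supported sequences with all terms in the rational span of `S`. -/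
def sequenceHull (ι : A →+ E) (S : AddSubgroup A) : Submodule ℚ (ℕ →₀ E) where
  carrier := {x | ∀ i, x i ∈ rationalHull ι S}
  zero_mem' _ := zero_mem _
  add_mem' hx hy i := add_mem (hx i) (hy i)
  smul_mem' q _ hx i := Submodule.smul_mem _ q (hx i)

theorem sequenceHull_mono (ι : A →+ E) {S T : AddSubgroup A} (h : S ≤ T) :
    sequenceHull ι S ≤ sequenceHull ι T := fun _ hx i => rationalHull_mono ι h (hx i)

theorem single_mem_sequenceHull (ι : A →+ E) {S : AddSubgroup A} {a : A} (ha : a ∈ S) (j : ℕ) :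
    Finsupp.single j (ι a) ∈ sequenceHull ι S := by
  classical
  intro i
  rw [Finsupp.single_apply]
  split_ifs
  · exact mem_rationalHull ι ha
  · exact zero_mem _

instance (ι : A →+ E) (S : AddSubgroup A) [Countable S] : Countable (sequenceHull ι S) := by
  refine Function.Injective.countable (f := fun x : sequenceHull ι S =>
    (Finsupp.onFinset x.1.support (fun i => (⟨x.1 i, x.2 i⟩ : rationalHull ι S)) (by
      intro i hi
      rw [Finsupp.mem_support_iff]
      exact fun h => hi (Subtype.ext h)) : ℕ →₀ rationalHull ι S)) fun x y h => ?_
  refine Subtype.ext (Finsupp.ext fun i => ?_)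
  exact congrArg Subtype.val (DFunLike.congr_fun h i)

variable (E) in
/-- The sequences supported on indices below `j`. -/
def lowerSequences (j : ℕ) : Submodule ℚ (ℕ →₀ E) where
  carrier := {x | ∀ i, j ≤ i → x i = 0}
  zero_mem' _ _ := rfl
  add_mem' hx hy i hi := by rw [Finsupp.add_apply, hx i hi, hy i hi, add_zero]
  smul_mem' q x hx i hi := by rw [Finsupp.smul_apply, hx i hi, smul_zero]

theorem lowerSequences_mono : Monotone (lowerSequences E) :=
  fun _ _ h _ hx i hi => hx i (h.trans hi)

theorem exists_mem_lowerSequences (x : ℕ →₀ E) : ∃ j, x ∈ lowerSequences E j := by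
  refine ⟨x.support.sup id + 1, fun i hi => ?_⟩
  by_contra h
  have := Finset.le_sup (f := id) (Finsupp.mem_support_iff.2 h)
  simp only [id] at this
  lia

/-- An increasing sequence of subgroups `G j` of `ℕ →₀ E`, where `G (j + 1)` is an extension of
`A` by `G j` through the `j`-th coordinate, such that for every stage `α` of the filtration,
every `g ∈ G j₀` from stage `α + 1` and every `v`, one of the extensions is twisted over
`C (α + 1)` by the multiple of `g` with the character `χ α v`. -/
structure IsTwistedTower (ι : A →+ E) (C : Ordinal.{0} → AddSubgroup A)
    (χ : Ordinal.{0} → ℤ → A →+ RatModInt) (G : ℕ → AddSubgroup (ℕ →₀ E)) : Prop where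
  le_lower : ∀ j, ∀ x ∈ G j, x ∈ lowerSequences E j
  le_succ : ∀ j, G j ≤ G (j + 1)
  mem_of_lower : ∀ j, ∀ x ∈ G (j + 1), x ∈ lowerSequences E j → x ∈ G j
  coord : ∀ j, ∀ x ∈ G (j + 1), ∃ a, x j = ι a
  surj : ∀ j a, ∃ y ∈ lowerSequences E j, y + Finsupp.single j (ι a) ∈ G (j + 1)
  twist : ∀ α < ω₁, ∀ j₀, ∀ g ∈ G j₀, g ∈ sequenceHull ι (C (α + 1)) → ∀ v : ℤ, ∃ j,
    ∀ a ∈ C (α + 1), ∃ q : ℚ, (q : RatModInt) = χ α v a ∧ ∃ d ∈ sequenceHull ι (C α),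
      q • g + d + Finsupp.single j (ι a) ∈ G (j + 1)

/-- An extension of `A` by `G` inside the rational space is given by a homomorphism `θ` from `A` to
the lower sequences modulo `G`. As `g α ∈ G`, the map `q ↦ q • g α` descends to `ℚ / ℤ`; composed
with `χ α` it gives the twist at stage `α`, and all stages are glued into one `θ`. -/
theorem IsCountableFiltration.exists_twisted_extension {C : Ordinal.{0} → AddSubgroup A}
    (hC : IsCountableFiltration C) (ι : A →+ E) (hι : Function.Injective ι)
    (χ : Ordinal.{0} → A →+ RatModInt) (hχ : ∀ α < ω₁, ∀ a ∈ C α, χ α a = 0) (j : ℕ)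
    (G : AddSubgroup (ℕ →₀ E)) (hG : ∀ x ∈ G, x ∈ lowerSequences E j)
    (g : Ordinal.{0} → ℕ →₀ E) (hg : ∀ α, g α ∈ G)
    (hgC : ∀ α, g α ∈ sequenceHull ι (C (α + 1))) :
    ∃ G' : AddSubgroup (ℕ →₀ E), (∀ x ∈ G', x ∈ lowerSequences E (j + 1)) ∧ G ≤ G' ∧
      (∀ x ∈ G', x ∈ lowerSequences E j → x ∈ G) ∧ (∀ x ∈ G', ∃ a, x j = ι a) ∧
      (∀ a, ∃ y ∈ lowerSequences E j, y + Finsupp.single j (ι a) ∈ G') ∧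
      ∀ α < ω₁, ∀ a ∈ C (α + 1), ∃ q : ℚ, (q : RatModInt) = χ α a ∧
        ∃ d ∈ sequenceHull ι (C α), q • g α + d + Finsupp.single j (ι a) ∈ G' := by
  let Wf : Ordinal.{0} → AddSubgroup ((ℕ →₀ E) ⧸ G) := fun α =>
    (lowerSequences E j ⊓ sequenceHull ι (C α)).toAddSubgroup.map (QuotientAddGroup.mk' G)
  let ρ : Ordinal.{0} → RatModInt →+ (ℕ →₀ E) ⧸ G := fun α =>
    QuotientAddGroup.lift (AddSubgroup.zmultiples (1 : ℚ))
      ((QuotientAddGroup.mk' G).comp ((LinearMap.toSpanSingleton ℚ _ (g α)).toAddMonoidHom)) (by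
        rintro _ ⟨n, rfl⟩
        refine (QuotientAddGroup.eq_zero_iff _).2 ?_
        have h : (LinearMap.toSpanSingleton ℚ _ (g α)) (n • (1 : ℚ)) = n • g α := by
          simp [Int.cast_smul_eq_zsmul]
        exact h ▸ G.zsmul_mem (hg α) n)
  have hρ : ∀ α (q : ℚ), ρ α (q : RatModInt) = ((q • g α : ℕ →₀ E) : (ℕ →₀ E) ⧸ G) :=
    fun α q => rfl
  have hmono : ∀ α β, α ≤ β → β < ω₁ → Wf α ≤ Wf β := fun α β hαβ hβ =>
    AddSubgroup.map_mono fun x hx => ⟨hx.1, sequenceHull_mono ι (hC.mono α β hαβ hβ) hx.2⟩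
  have hdiv : ∀ α, ∀ n : ℤ, n ≠ 0 → ∀ x ∈ Wf α, ∃ y ∈ Wf α, n • y = x := by
    rintro α n hn _ ⟨x, hx, rfl⟩
    refine ⟨_, ⟨(n : ℚ)⁻¹ • x,
      (lowerSequences E j ⊓ sequenceHull ι (C α)).smul_mem (n : ℚ)⁻¹ hx, rfl⟩, ?_⟩
    rw [← map_zsmul, ← Int.cast_smul_eq_zsmul ℚ, smul_smul,
      mul_inv_cancel₀ (by exact_mod_cast hn), one_smul]
  have hw0 : ∀ α < ω₁, ∀ a ∈ C α, (ρ α).comp (χ α) a = 0 := by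
    intro α hα a ha
    rw [AddMonoidHom.comp_apply, hχ α hα a ha, map_zero]
  have hw : ∀ α < ω₁, ∀ a, (ρ α).comp (χ α) a ∈ Wf (α + 1) := by
    intro α hα a
    obtain ⟨q, hq⟩ := QuotientAddGroup.mk_surjective (χ α a)
    rw [AddMonoidHom.comp_apply, ← hq]
    exact ⟨q • g α, ⟨Submodule.smul_mem _ q (hG _ (hg α)), Submodule.smul_mem _ q (hgC α)⟩, rfl⟩
  obtain ⟨θ, hθ, hθw⟩ := hC.exists_twisted_hom Wf hmono hdiv _ hw0 hw
  have hθlow : ∀ a, ∃ y ∈ lowerSequences E j, (y : (ℕ →₀ E) ⧸ G) = θ a := by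
    intro a
    obtain ⟨α, hα, ha⟩ := hC.exhaust a
    obtain ⟨y, hy, hya⟩ := hθ α hα a ha
    exact ⟨y, hy.1, hya⟩
  let G' : AddSubgroup (ℕ →₀ E) :=
    { carrier := {x | ∃ y ∈ lowerSequences E j, ∃ a, (y : (ℕ →₀ E) ⧸ G) = θ a ∧
        x = y + Finsupp.single j (ι a)}
      zero_mem' := ⟨0, zero_mem _, 0, by simp, by simp⟩
      add_mem' := by
        rintro _ _ ⟨y, hy, a, hya, rfl⟩ ⟨z, hz, b, hzb, rfl⟩
        refine ⟨y + z, add_mem hy hz, a + b, ?_, ?_⟩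
        · rw [map_add, ← hya, ← hzb]; rfl
        · rw [map_add, Finsupp.single_add]; abel
      neg_mem' := by
        rintro _ ⟨y, hy, a, hya, rfl⟩
        refine ⟨-y, neg_mem hy, -a, ?_, ?_⟩
        · rw [map_neg, ← hya]; rfl
        · rw [map_neg, Finsupp.single_neg]; abel }
  have hcoord : ∀ y ∈ lowerSequences E j, ∀ a, (y + Finsupp.single j (ι a)) j = ι a := by
    intro y hy a
    rw [Finsupp.add_apply, hy j le_rfl, Finsupp.single_eq_same, zero_add]
  refine ⟨G', ?_, ?_, ?_, ?_, ?_, ?_⟩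
  · rintro _ ⟨y, hy, a, -, rfl⟩ i hi
    rw [Finsupp.add_apply, hy i (by lia), Finsupp.single_eq_of_ne (by lia), add_zero]
  · intro x hx
    refine ⟨x, hG x hx, 0, ?_, by simp⟩
    rw [map_zero]
    exact (QuotientAddGroup.eq_zero_iff x).2 hx
  · rintro _ ⟨y, hy, a, hya, rfl⟩ hlow
    have h0 : ι a = 0 := by rw [← hcoord y hy a]; exact hlow j le_rfl
    have ha : a = 0 := hι (h0.trans (map_zero ι).symm)
    subst ha
    rw [map_zero] at hya
    simpa using (QuotientAddGroup.eq_zero_iff y).1 hya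
  · rintro _ ⟨y, hy, a, -, rfl⟩
    exact ⟨a, hcoord y hy a⟩
  · intro a
    obtain ⟨y, hy, hya⟩ := hθlow a
    exact ⟨y, hy, y, hy, a, hya, rfl⟩
  · intro α hα a ha
    obtain ⟨q, hq⟩ := QuotientAddGroup.mk_surjective (χ α a)
    obtain ⟨d, hd, hda⟩ := hθw α hα a ha
    refine ⟨q, hq, d, hd.2, q • g α + d,
      add_mem (Submodule.smul_mem _ q (hG _ (hg α))) hd.1, a, ?_, rfl⟩
    have h1 : ((d : ℕ →₀ E) : (ℕ →₀ E) ⧸ G) = θ a - ρ α (χ α a) := hda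
    rw [← hq] at h1
    have h2 : ρ α (QuotientAddGroup.mk q) = ((q • g α : ℕ →₀ E) : (ℕ →₀ E) ⧸ G) := hρ α q
    rw [QuotientAddGroup.mk_add, h1, h2, add_sub_cancel]

theorem IsCountableFiltration.exists_twistedTower {C : Ordinal.{0} → AddSubgroup A}
    (hC : IsCountableFiltration C) (ι : A →+ E) (hι : Function.Injective ι)
    (χ : Ordinal.{0} → ℤ → A →+ RatModInt) (hχ : ∀ α < ω₁, ∀ v, ∀ a ∈ C α, χ α v a = 0) :
    ∃ G : ℕ → AddSubgroup (ℕ →₀ E), IsTwistedTower ι C χ G := by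
  classical
  have henum : ∀ α, ∃ e : ℕ → sequenceHull ι (C (α + 1)) × ℤ, α < ω₁ → Function.Surjective e := by
    intro α
    by_cases hα : α < ω₁
    · have := hC.countable _ (succ_lt_omega_one hα)
      obtain ⟨e, he⟩ := exists_surjective_nat (sequenceHull ι (C (α + 1)) × ℤ)
      exact ⟨e, fun _ => he⟩
    · exact ⟨fun _ => 0, fun h => absurd h hα⟩
  choose e he using henum
  -- Step `j` treats all `α` at once, using for each the pair numbered `j.unpair.1`; if its element
  -- is not yet in `G`, the default `0` gives no twist.
  have step := fun (j : ℕ) (G : AddSubgroup (ℕ →₀ E)) (hG : ∀ x ∈ G, x ∈ lowerSequences E j) =>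
    hC.exists_twisted_extension ι hι (fun α => χ α (e α j.unpair.1).2)
      (fun α hα => hχ α hα _) j G hG
      (fun α => if ((e α j.unpair.1).1 : ℕ →₀ E) ∈ G then (e α j.unpair.1).1 else 0)
      (fun α => by split_ifs with h; exacts [h, G.zero_mem])
      (fun α => by split_ifs with h; exacts [(e α j.unpair.1).1.2, zero_mem _])
  choose! next hnext using step
  let G : ℕ → AddSubgroup (ℕ →₀ E) := fun n => Nat.rec ⊥ next n
  have hlow : ∀ j, ∀ x ∈ G j, x ∈ lowerSequences E j := by
    intro j
    induction j with
    | zero =>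
      rintro x hx
      rw [AddSubgroup.mem_bot.1 hx]
      exact zero_mem _
    | succ j ih => exact (hnext j (G j) ih).1
  have hmono : Monotone G := monotone_nat_of_le_succ fun j => (hnext j (G j) (hlow j)).2.1
  refine ⟨G, hlow, fun j => hmono j.le_succ, fun j => (hnext j (G j) (hlow j)).2.2.1,
    fun j => (hnext j (G j) (hlow j)).2.2.2.1, fun j => (hnext j (G j) (hlow j)).2.2.2.2.1, ?_⟩
  intro α hα j₀ g hg hgC v
  obtain ⟨n, hn⟩ := he α hα (⟨g, hgC⟩, v)
  -- This index is at least `j₀`, so `g` is already present and the default is avoided.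
  refine ⟨Nat.pair n j₀, fun a ha => ?_⟩
  have := (hnext (Nat.pair n j₀) (G _) (hlow _)).2.2.2.2.2 α hα a ha
  have he' : e α (Nat.unpair (Nat.pair n j₀)).1 = (⟨g, hgC⟩, v) := by rw [Nat.unpair_pair, hn]
  rw [if_pos (by rw [he']; exact hmono (Nat.right_le_pair n j₀) hg), he'] at this
  exact this

end TwistedTower

/-! ### The union is a Whitehead group of size `ℵ₁` -/

namespace IsTwistedTower

variable {A E : Type} [AddCommGroup A] [AddCommGroup E] [Module ℚ E]
  {ι : A →+ E} {C : Ordinal.{0} → AddSubgroup A} {χ : Ordinal.{0} → ℤ → A →+ RatModInt}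
  {G : ℕ → AddSubgroup (ℕ →₀ E)}

theorem mono (hG : IsTwistedTower ι C χ G) : Monotone G := monotone_nat_of_le_succ hG.le_succ

theorem mem_iSup (hG : IsTwistedTower ι C χ G) {x : ℕ →₀ E} : x ∈ ⨆ j, G j ↔ ∃ j, x ∈ G j :=
  AddSubgroup.mem_iSup_of_directed hG.mono.directed_le

theorem exists_zsmul_mem (hG : IsTwistedTower ι C χ G)
    (hE : ∀ e : E, ∃ n : ℤ, n ≠ 0 ∧ ∃ a, n • e = ι a) (x : ℕ →₀ E) :
    ∃ n : ℤ, n ≠ 0 ∧ n • x ∈ ⨆ j, G j := by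
  have key : ∀ j, ∀ x ∈ lowerSequences E j, ∃ n : ℤ, n ≠ 0 ∧ n • x ∈ G j := by
    intro j
    induction j with
    | zero =>
      intro x hx
      have : x = 0 := Finsupp.ext fun i => hx i i.zero_le
      exact ⟨1, one_ne_zero, by rw [this, smul_zero]; exact zero_mem _⟩
    | succ j ih =>
      intro x hx
      obtain ⟨n, hn, a, ha⟩ := hE (x j)
      obtain ⟨y, hy, hya⟩ := hG.surj j a
      have hz : n • x - (y + Finsupp.single j (ι a)) ∈ lowerSequences E j := by
        intro i hi
        rcases hi.eq_or_lt with rfl | hlt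
        · simp [ha, hy j le_rfl]
        · have h1 : x i = 0 := hx i hlt
          simp [h1, hy i hi, Finsupp.single_eq_of_ne hlt.ne']
      obtain ⟨m, hm, hmz⟩ := ih _ hz
      refine ⟨m * n, mul_ne_zero hm hn, ?_⟩
      have := add_mem (hG.le_succ j hmz) ((G (j + 1)).zsmul_mem hya m)
      rwa [← smul_add, sub_add_cancel, smul_smul] at this
  obtain ⟨j, hj⟩ := exists_mem_lowerSequences x
  obtain ⟨n, hn, h⟩ := key j x hj
  exact ⟨n, hn, hG.mem_iSup.2 ⟨j, h⟩⟩

/-- The union of a twisted tower over a Whitehead group is a Whitehead group. -/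
theorem liftsCharacters (hG : IsTwistedTower ι C χ G) (hι : Function.Injective ι)
    (hA : LiftsCharacters A) : LiftsCharacters ↥(⨆ j, G j) := by
  intro η
  have hmem : ∀ {j x}, x ∈ G j → x ∈ ⨆ j, G j := fun {j x} h => hG.mem_iSup.2 ⟨j, h⟩
  have step : ∀ (j : ℕ) (Φ : (ℕ →₀ E) →+ ℚ),
      (∀ x (hx : x ∈ G j), (Φ x : RatModInt) = η ⟨x, hmem hx⟩) →
      ∃ Φ' : (ℕ →₀ E) →+ ℚ, (∀ x (hx : x ∈ G (j + 1)), (Φ' x : RatModInt) = η ⟨x, hmem hx⟩) ∧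
        ∀ x ∈ lowerSequences E j, Φ' x = Φ x := by
    intro j Φ hΦ
    let π : (ℕ →₀ E) →+ E := Finsupp.applyAddHom j
    let κ : ℚ →+ RatModInt := QuotientAddGroup.mk' _
    -- The error of `Φ` on `G (j + 1)` vanishes on `G j`, the kernel of coordinate `j`, so it is a
    -- character of that coordinate; its restriction to `A` lifts, and the lift corrects `Φ`.
    obtain ⟨ζ, hζ⟩ := exists_factor_of_ker_le (π.comp (G (j + 1)).subtype)
      (η.comp (AddSubgroup.inclusion fun x hx => hmem hx) -
        (κ.comp Φ).comp (G (j + 1)).subtype) (by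
        rintro ⟨x, hx⟩ (h0 : x j = 0)
        have hlow : x ∈ lowerSequences E j := fun i hi => by
          rcases hi.eq_or_lt with rfl | hlt
          · exact h0
          · exact hG.le_lower _ x hx i hlt
        have := hΦ x (hG.mem_of_lower j x hx hlow)
        exact sub_eq_zero.2 this.symm)
    obtain ⟨μ, hμ⟩ := hA (ζ.comp ι)
    obtain ⟨ℓ, hℓ⟩ := exists_extension_of_injective ι hι μ
    refine ⟨Φ + ℓ.comp π, fun x hx => ?_, fun x hx => ?_⟩
    · obtain ⟨a, ha⟩ := hG.coord j x hx
      have h1 : ζ (x j) = η ⟨x, hmem hx⟩ - κ (Φ x) := hζ ⟨x, hx⟩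
      have h2 : κ (ℓ (x j)) = ζ (x j) := by
        rw [ha, hℓ]
        exact hμ a
      change κ (Φ x + ℓ (x j)) = _
      rw [map_add, h2, h1, add_sub_cancel]
    · have h0 : x j = 0 := hx j le_rfl
      change Φ x + ℓ (x j) = Φ x
      rw [h0, map_zero, add_zero]
  choose! next hnext hext using step
  let Φ : ℕ → (ℕ →₀ E) →+ ℚ := fun n => Nat.rec 0 next n
  have hΦ : ∀ j x (hx : x ∈ G j), (Φ j x : RatModInt) = η ⟨x, hmem hx⟩ := by
    intro j
    induction j with
    | zero =>
      intro x hx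
      have h0 : x = 0 := Finsupp.ext fun i => hG.le_lower 0 x hx i i.zero_le
      subst h0
      exact (map_zero η).symm
    | succ j ih => exact hnext j (Φ j) ih
  have hstable : ∀ i j, i ≤ j → ∀ x ∈ lowerSequences E i, Φ j x = Φ i x := by
    intro i j hij
    induction j, hij using Nat.le_induction with
    | base => exact fun _ _ => rfl
    | succ j hij ih =>
      exact fun x hx => (hext j (Φ j) (hΦ j) x (lowerSequences_mono hij hx)).trans (ih x hx)
  choose k hk using exists_mem_lowerSequences (E := E)
  have hval : ∀ x j, x ∈ lowerSequences E j → Φ (k x) x = Φ j x := by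
    intro x j hx
    rcases le_total (k x) j with h | h
    · exact (hstable _ _ h x (hk x)).symm
    · exact hstable _ _ h x hx
  refine ⟨(AddMonoidHom.mk' (fun x => Φ (k x) x) fun x y => ?_).comp (AddSubgroup.subtype _),
    fun x => ?_⟩
  · have hx := lowerSequences_mono (le_max_left (k x) (k y)) (hk x)
    have hy := lowerSequences_mono (le_max_right (k x) (k y)) (hk y)
    rw [hval _ _ hx, hval _ _ hy, hval _ _ (add_mem hx hy), map_add]
  · obtain ⟨j, hj⟩ := hG.mem_iSup.1 x.2
    change ((Φ (k x) x : ℚ) : RatModInt) = _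
    rw [hval _ _ (hG.le_lower j _ hj), hΦ j _ hj]

theorem mk_eq_aleph_one (hG : IsTwistedTower ι C χ G) (hι : Function.Injective ι)
    (hE : ∀ e : E, ∃ n : ℤ, n ≠ 0 ∧ ∃ a, n • e = ι a) (hA : #A = ℵ₁) :
    #↥(⨆ j, G j) = ℵ₁ := by
  have hA0 : ℵ₀ < #A := hA ▸ Cardinal.aleph_one_le_iff.1 le_rfl
  apply le_antisymm
  · have : Infinite A := Cardinal.infinite_iff.2 hA0.le
    have : Infinite E := Infinite.of_injective ι hι
    have hE' : #E ≤ ℵ₁ := by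
      have hsurj : Function.Surjective fun p : ℤ × A => (p.1 : ℚ)⁻¹ • ι p.2 := fun e => by
        obtain ⟨n, hn, a, ha⟩ := hE e
        exact ⟨(n, a), (eq_inv_smul_of_zsmul_eq hn ha).symm⟩
      refine (Cardinal.mk_le_of_surjective hsurj).trans ?_
      rw [Cardinal.mk_prod, Cardinal.lift_id, Cardinal.lift_id, Cardinal.mk_int, hA]
      exact Cardinal.mul_le_of_le (Cardinal.aleph0_le_aleph 1) (Cardinal.aleph0_le_aleph 1) le_rfl
    calc #↥(⨆ j, G j) ≤ #(ℕ →₀ E) := Cardinal.mk_subtype_le _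
      _ = max #ℕ #E := Cardinal.mk_finsupp_of_infinite ℕ E
      _ ≤ ℵ₁ := max_le (by simp) hE'
  · rw [← hA]
    have hmem : ∀ a, Finsupp.single 0 (ι a) ∈ ⨆ j, G j := fun a => by
      obtain ⟨y, hy, hya⟩ := hG.surj 0 a
      have : y = 0 := Finsupp.ext fun i => hy i i.zero_le
      rw [this, zero_add (Finsupp.single 0 (ι a))] at hya
      exact hG.mem_iSup.2 ⟨1, hya⟩
    refine Cardinal.mk_le_of_injective (f := fun a => (⟨_, hmem a⟩ : ↥(⨆ j, G j))) fun a b h => ?_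
    exact hι (Finsupp.single_injective 0 (congrArg Subtype.val h))

end IsTwistedTower

/-! ### Homomorphisms into `ℵ₁`-free groups -/

theorem IsCountableFiltration.exists_mem_sequenceHull {A E : Type} [AddCommGroup A]
    [AddCommGroup E] [Module ℚ E] {C : Ordinal.{0} → AddSubgroup A} (hC : IsCountableFiltration C)
    (ι : A →+ E) {δ : Ordinal.{0}} (h0 : 0 < δ) (hδ : δ ≤ ω₁) (x : ℕ →₀ E)
    (hx : ∀ i, ∃ α < δ, x i ∈ rationalHull ι (C α)) : ∃ α < δ, x ∈ sequenceHull ι (C α) := by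
  choose f hf hxf using hx
  have hsup : x.support.sup f < δ := (Finset.sup_lt_iff (by simpa using h0)).2 fun i _ => hf i
  refine ⟨x.support.sup f, hsup, fun i => ?_⟩
  by_cases hi : i ∈ x.support
  · exact rationalHull_mono ι (hC.mono _ _ (Finset.le_sup hi) (hsup.trans_le hδ)) (hxf i)
  · rw [Finsupp.notMem_support_iff.1 hi]
    exact zero_mem _

/-- In a free abelian group every nonzero element has a nonzero coordinate. -/
theorem exists_hom_int_ne_zero {F : Type*} [AddCommGroup F] [Module.Free ℤ F] {x : F}
    (hx : x ≠ 0) : ∃ φ : F →+ ℤ, φ x ≠ 0 := by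
  let b := Module.Free.chooseBasis ℤ F
  by_contra! h
  exact hx (b.ext_elem fun i => by simpa using h (b.coord i).toAddMonoidHom)

theorem isAlephOneFree_int : IsAlephOneFree ℤ := fun B _ =>
  inferInstanceAs (Module.Free ℤ (AddSubgroup.toIntSubmodule B))

/-- A homomorphism from a countable group into an `ℵ₁`-free group that does not vanish at `x` can
be composed to a homomorphism into `ℤ` that does not vanish at `x`. -/
theorem IsAlephOneFree.exists_hom_int {H D : Type} [AddCommGroup H] [Countable H] [AddCommGroup D]
    (hD : IsAlephOneFree D) (ψ : H →+ D) {x : H} (hx : ψ x ≠ 0) :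
    ∃ φ : H →+ ℤ, φ x ≠ 0 ∧ ∀ y, ψ y = 0 → φ y = 0 := by
  have hc : Countable ψ.range := ψ.rangeRestrict_surjective.countable
  have := hD ψ.range hc
  obtain ⟨φ, hφ⟩ := exists_hom_int_ne_zero (x := ψ.rangeRestrict x)
    fun h => hx (congrArg Subtype.val h)
  refine ⟨φ.comp ψ.rangeRestrict, hφ, fun y hy => ?_⟩
  have : ψ.rangeRestrict y = 0 := Subtype.ext hy
  rw [AddMonoidHom.comp_apply, this, map_zero]

/-- A homomorphism from the union of a suitably twisted tower into an `ℵ₁`-free group vanishes if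
it vanishes on the bottom of the filtration. -/
theorem IsTwistedTower.hom_eq_zero {A E D : Type} [AddCommGroup A] [AddCommGroup E] [Module ℚ E]
    [AddCommGroup D] {ι : A →+ E} {C : Ordinal.{0} → AddSubgroup A}
    {χ : Ordinal.{0} → ℤ → A →+ RatModInt} {G : ℕ → AddSubgroup (ℕ →₀ E)}
    (hG : IsTwistedTower ι C χ G) (hC : IsCountableFiltration C)
    (hE : ∀ e : E, ∃ n : ℤ, n ≠ 0 ∧ ∃ a, n • e = ι a)
    (hχ : ∀ α < ω₁, ¬ C (α + 1) ≤ C α → ∀ v : ℤ, v ≠ 0 →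
      ¬ ∃ μ : A →+ ℚ, (∀ a ∈ C α, μ a = 0) ∧ ∀ a ∈ C (α + 1), (μ a : RatModInt) = v • χ α v a)
    (hD : IsAlephOneFree D) (ψ : ↥(⨆ j, G j) →+ D)
    (h0 : ∀ x : ↥(⨆ j, G j), (x : ℕ →₀ E) ∈ sequenceHull ι (C 0) → ψ x = 0) : ψ = 0 := by
  have key : ∀ α < ω₁, ∀ x : ↥(⨆ j, G j), (x : ℕ →₀ E) ∈ sequenceHull ι (C α) → ψ x = 0 := by
    intro α
    induction α using Ordinal.limitRecOn with
    | zero => exact fun _ => h0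
    | limit δ hδ ih =>
      intro hδω x hx
      obtain ⟨α, hα, hxα⟩ := hC.exists_mem_sequenceHull ι (hδ.bot_lt) hδω.le x fun i => by
        obtain ⟨n, hn, a, ha, hna⟩ := hx i
        obtain ⟨α, hα, haα⟩ := hC.continuous δ hδ hδω a ha
        exact ⟨α, hα, n, hn, a, haα, hna⟩
      exact ih α hα (hα.trans hδω) x hxα
    | add_one α ih =>
      intro hα1 x hx
      by_contra hne
      have hα : α < ω₁ := (Order.lt_add_one_iff.2 le_rfl).trans hα1
      have hCle : C α ≤ C (α + 1) := hC.mono _ _ (Order.lt_add_one_iff.2 le_rfl).le hα1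
      have hproper : ¬ C (α + 1) ≤ C α := fun h =>
        hne (ih hα x (sequenceHull_mono ι h hx))
      have hcount := hC.countable _ hα1
      let H : AddSubgroup (ℕ →₀ E) := (⨆ j, G j) ⊓ (sequenceHull ι (C (α + 1))).toAddSubgroup
      have hHcount : Countable H := by
        refine Function.Injective.countable
          (f := fun y : H => (⟨y.1, y.2.2⟩ : sequenceHull ι (C (α + 1)))) fun y z h => ?_
        exact Subtype.ext (congrArg (fun w : sequenceHull ι (C (α + 1)) => (w : ℕ →₀ E)) h)
      obtain ⟨φ, hφx, hφ⟩ := hD.exists_hom_int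
        (ψ.comp (AddSubgroup.inclusion (inf_le_left : H ≤ ⨆ j, G j))) (x := ⟨x.1, x.2, hx⟩) hne
      obtain ⟨Φ, hΦ⟩ := exists_extension_of_injective H.subtype Subtype.val_injective
        ((Int.castAddHom ℚ).comp φ)
      have hΦH : ∀ y (hy : y ∈ H), Φ y = φ ⟨y, hy⟩ := fun y hy => hΦ ⟨y, hy⟩
      -- The vector `d` need not lie in the union, but a nonzero multiple does, and `ℚ` is
      -- torsion-free.
      have hΦ0 : ∀ d ∈ sequenceHull ι (C α), Φ d = 0 := by
        intro d hd
        obtain ⟨n, hn, hnd⟩ := hG.exists_zsmul_mem hE d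
        have hnd' : n • d ∈ sequenceHull ι (C α) := by
          rw [← Int.cast_smul_eq_zsmul ℚ]
          exact Submodule.smul_mem _ _ hd
        have h1 := hΦH (n • d) ⟨hnd, sequenceHull_mono ι hCle hnd'⟩
        rw [hφ _ (ih hα ⟨n • d, hnd⟩ hnd'), map_zsmul, Int.cast_zero] at h1
        exact (smul_eq_zero.1 h1).resolve_left hn
      obtain ⟨j₀, hj₀⟩ := hG.mem_iSup.1 x.2
      set v : ℤ := φ ⟨x.1, x.2, hx⟩
      -- The sign: `Φ` is integral at `q • x + d + single j (ι a)`, so modulo `ℤ` its value at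
      -- `single j (ι a)` is `-v * q`, that is, `-v` times the character.
      obtain ⟨j, hj⟩ := hG.twist α hα j₀ x hj₀ hx (-v)
      refine hχ α hα hproper (-v) (neg_ne_zero.2 hφx)
        ⟨Φ.comp ((Finsupp.singleAddHom j).comp ι), fun a ha => ?_, fun a ha => ?_⟩
      · exact hΦ0 _ (single_mem_sequenceHull ι ha j)
      · obtain ⟨q, hq, d, hd, hmem⟩ := hj a ha
        have hmemH : q • (x : ℕ →₀ E) + d + Finsupp.single j (ι a) ∈ H :=
          ⟨hG.mem_iSup.2 ⟨_, hmem⟩, add_mem (add_mem (Submodule.smul_mem _ q hx)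
            (sequenceHull_mono ι hCle hd)) (single_mem_sequenceHull ι ha j)⟩
        have h1 := hΦH _ hmemH
        rw [map_add, map_add, hΦ0 d hd, map_rat_smul, hΦH x ⟨x.2, hx⟩, add_zero, smul_eq_mul] at h1
        rw [← hq]
        change ((Φ (Finsupp.single j (ι a)) : ℚ) : RatModInt) = _
        rw [← AddCircle.coe_zsmul, ← sub_eq_zero, ← AddCircle.coe_sub,
          ratModInt_coe_eq_zero_iff]
        refine ⟨_, h1.symm.trans ?_⟩
        rw [zsmul_eq_mul]
        push_cast
        ring
  ext x
  obtain ⟨α, hα, hx⟩ := hC.exists_mem_sequenceHull ι (Ordinal.omega_pos 1) le_rfl x fun i => by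
    obtain ⟨n, hn, a, hna⟩ := hE (x.1 i)
    obtain ⟨α, hα, ha⟩ := hC.exhaust a
    exact ⟨α, hα, n, hn, a, ha, hna⟩
  exact key α hα x hx

/-- An uncountable group `G` is not strongly `ℵ₁`-free if every homomorphism into an `ℵ₁`-free group
that vanishes on some fixed countable subset is zero. -/
theorem not_isStronglyAlephOneFree {G : Type} [AddCommGroup G] (hG : Uncountable G) (X : Set G)
    (hX : X.Countable)
    (h : ∀ (D : Type) [AddCommGroup D], IsAlephOneFree D → ∀ ψ : G →+ D, (∀ x ∈ X, ψ x = 0) →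
      ψ = 0) : ¬ IsStronglyAlephOneFree G := by
  intro hs
  obtain ⟨B, hXB, hB, hGB⟩ := hs X hX
  have hψ := h (G ⧸ B) hGB (QuotientAddGroup.mk' B) fun x hx =>
    (QuotientAddGroup.eq_zero_iff x).2 (hXB hx)
  have htop : ∀ x, x ∈ B := fun x => (QuotientAddGroup.eq_zero_iff x).1 (DFunLike.congr_fun hψ x)
  have hfree : Module.Free ℤ G :=
    Module.Free.of_equiv (AddEquiv.ofBijective B.subtype
      ⟨Subtype.val_injective, fun x => ⟨⟨x, htop x⟩, rfl⟩⟩).toIntLinearEquiv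
  let b := Module.Free.chooseBasis ℤ G
  have hJ : (⋃ x ∈ X, ((b.repr x).support : Set (Module.Free.ChooseBasisIndex ℤ G))).Countable :=
    hX.biUnion fun x _ => (b.repr x).support.countable_toSet
  -- `X` involves only countably many basis elements; a coordinate outside them kills `X`, so the
  -- hypothesis applied to `ℤ` gives a contradiction.
  have hI : ¬ Countable (Module.Free.ChooseBasisIndex ℤ G) := fun hI =>
    not_countable_iff.2 hG b.repr.injective.countable
  obtain ⟨i, hi⟩ : ∃ i, i ∉ ⋃ x ∈ X, ((b.repr x).support : Set (Module.Free.ChooseBasisIndex ℤ G)) := by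
    by_contra! hall
    exact hI (Set.countable_univ_iff.1 (hJ.mono fun i _ => hall i))
  have h0 := h ℤ isAlephOneFree_int (b.coord i).toAddMonoidHom fun x hx => by
    by_contra hne
    exact hi (Set.mem_biUnion hx (Finsupp.mem_support_iff.2 hne))
  have h1 : b.coord i (b i) = 0 := DFunLike.congr_fun h0 (b i)
  simp at h1

theorem theorem1p4
    (h : ∃ (A : Type) (_ : AddCommGroup A),
      Cardinal.mk A = ℵ₁ ∧ IsWhitehead A ∧ GammaEqOne A) :
    ∃ (G : Type) (_ : AddCommGroup G),
      Cardinal.mk G = ℵ₁ ∧ IsWhitehead G ∧ ¬ IsStronglyAlephOneFree G := by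
  obtain ⟨A, _, hcard, hW, C₀, hC₀, hfree⟩ := h
  have hA := (isWhitehead_iff_liftsCharacters A).1 hW
  obtain ⟨C, hC, hχ⟩ := hC₀.exists_character_filtration hA hfree
  have htf : IsAddTorsionFree A := by
    have : Module.IsTorsionFree ℤ A := by
      rw [Module.isTorsionFree_iff_smul_eq_zero]
      intro n a hna
      exact or_iff_not_imp_left.2 fun hn => hA.eq_zero_of_smul_eq_zero hn hna
    exact Module.isTorsionFree_int_iff_isAddTorsionFree.1 this
  have hchar : ∀ (α : Ordinal.{0}) (v : ℤ), ∃ χ : A →+ RatModInt,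
      (α < ω₁ → ∀ a ∈ C α, χ a = 0) ∧ (α < ω₁ → ¬ C (α + 1) ≤ C α → v ≠ 0 →
        ¬ ∃ μ : A →+ ℚ, (∀ a ∈ C α, μ a = 0) ∧
          ∀ a ∈ C (α + 1), (μ a : RatModInt) = v • χ a) := by
    intro α v
    by_cases hcase : α < ω₁ ∧ ¬ C (α + 1) ≤ C α ∧ v ≠ 0
    · obtain ⟨χ, h1, h2⟩ := hχ α hcase.1 hcase.2.1 v hcase.2.2
      exact ⟨χ, fun _ => h1, fun _ _ _ => h2⟩
    · exact ⟨0, fun _ _ _ => rfl, fun h1 h2 h3 => absurd ⟨h1, h2, h3⟩ hcase⟩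
  choose χ hχ0 hχ1 using hchar
  let ι : A →+ DivisibleHull A := DivisibleHull.coeAddMonoidHom A
  have hι : Function.Injective ι := DivisibleHull.coe_injective
  have hE : ∀ e : DivisibleHull A, ∃ n : ℤ, n ≠ 0 ∧ ∃ a, n • e = ι a := by
    intro e
    induction e with
    | mk a s =>
      refine ⟨s, by exact_mod_cast s.ne_zero, a, ?_⟩
      rw [DivisibleHull.zsmul_mk]
      exact DivisibleHull.mk_eq_mk_iff_smul_eq_smul.2 (by simp)
  obtain ⟨G, hG⟩ := hC.exists_twistedTower ι hι χ fun α hα v => hχ0 α v hα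
  have hGcard := hG.mk_eq_aleph_one hι hE hcard
  refine ⟨↥(⨆ j, G j), inferInstance, hGcard,
    (isWhitehead_iff_liftsCharacters _).2 (hG.liftsCharacters hι hA), ?_⟩
  have := hC.countable 0 (Ordinal.omega_pos 1)
  refine not_isStronglyAlephOneFree ?_ {x | (x : ℕ →₀ DivisibleHull A) ∈ sequenceHull ι (C 0)} ?_ ?_
  · rw [← Cardinal.aleph0_lt_mk_iff, hGcard]
    exact Cardinal.aleph_one_le_iff.1 le_rfl
  · have hc : (sequenceHull ι (C 0) : Set (ℕ →₀ DivisibleHull A)).Countable :=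
      Set.countable_coe_iff.1 (inferInstanceAs (Countable (sequenceHull ι (C 0))))
    exact hc.preimage Subtype.val_injective
  · intro D _ hD ψ h0
    exact hG.hom_eq_zero hC hE (fun α hα hp v hv => hχ1 α v hα hp hv) hD ψ h0
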